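/- For a cardinal $\kappa$, let ${\sf MA}(\kappa)$ be Martin's axiom for ccc partial orders and $\kappa$ many dense sets: for every nonempty partial order $P$ in which every set of pairwise incompatible elements is countable (two elements are incompatible if they have no common lower bound), and every family $\mathcal D$ of at most $\kappa$ dense subsets of $P$ ($D\subseteq P$ is dense if every $p\in P$ has some $q\in D$ with $q\le p$), there is a filter $G\subseteq P$ (nonempty, upward closed, downward directed) with $G\cap D\neq\emptyset$ for all $D\in\mathcal D$. A topological space is scattered if each of its nonempty subsets contains a point that is isolated in that subset. Its height is the first ordinal $\alpha$ such that the Cantor--Bendixson derivative $K^{(\alpha)}$ is empty, where $K^{(0)}=K$, $K^{(\alpha+1)}$ is the set of non-isolated points of $K^{(\alpha)}$, and intersections are taken at limit steps. The weight of a space is the least cardinality of a base of its topology. For a compact space $K$, $C(K)$ is the Banach space of continuous functions $K\to\mathbb R$ with the supremum norm. **Corollary.** Let $\kappa$ be a cardinal and assume ${\sf MA}(\kappa)$. If $K_0$ and $K_1$ are separable scattered compact Hausdorff spaces of height $3$ and weight $\kappa$, then the Banach spaces $C(K_0)$ and $C(K_1)$ are isomorphic, i.e. there is a linear homeomorphism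 $C(K_0)\to C(K_1)$. -/

import Mathlib

open Set Topology Cardinal Ordinal

universe u

/-- Two elements of a partial order are compatible if they have a common lower bound
(a common extension). -/
def Compatible {P : Type u} [PartialOrder P] (p q : P) : Prop :=
  ∃ r : P, r ≤ p ∧ r ≤ q

/-- The countable chain condition for a partial order: every set of pairwise incompatible
elements is countable. -/
def CountableChainCondition (P : Type u) [PartialOrder P] : Prop :=
  ∀ A : Set P, A.Pairwise (fun p q => ¬ Compatible p q) → A.Countable

/-- A subset of a partial order is dense if every element has an extension (a smaller element)
in it. -/
def DenseInOrder {P : Type u} [PartialOrder P] (D : Set P) : Prop :=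
  ∀ p : P, ∃ q ∈ D, q ≤ p

/-- Martin's axiom `MA(κ)`: for every nonempty ccc partial order and every family of at most `κ`
dense subsets there is a filter (nonempty, upward closed, downward directed) that meets every
member of the family. -/
def MartinAxiom (κ : Cardinal.{u}) : Prop :=
  ∀ (P : Type u) [PartialOrder P] [Nonempty P], CountableChainCondition P →
    ∀ 𝒟 : Set (Set P), #𝒟 ≤ κ → (∀ D ∈ 𝒟, DenseInOrder D) →
      ∃ G : Order.PFilter P, ∀ D ∈ 𝒟, ((G : Set P) ∩ D).Nonempty

/-- A topological space is scattered if each of its nonempty subsets has a point that is isolated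
in that subset. -/
def IsScatteredSpace (X : Type u) [TopologicalSpace X] : Prop :=
  ∀ s : Set X, s.Nonempty → ∃ x ∈ s, ∃ U : Set X, IsOpen U ∧ U ∩ s = {x}

/-- `X` has (Cantor-Bendixson) height `α`: `α` is the first ordinal for which the `α`-th
Cantor-Bendixson derivative of `X` is empty. -/
def HasHeight (X : Type u) [TopologicalSpace X] (α : Ordinal.{u}) : Prop :=
  IsLeast {β : Ordinal.{u} | CantorBendixson.iteratedDerivedSet (Set.univ : Set X) β = ∅} α

/-- The weight of a topological space: the least cardinality of a base. -/
noncomputable def topWeight (X : Type u) [TopologicalSpace X] : Cardinal.{u} :=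
  sInf {c : Cardinal.{u} | ∃ B : Set (Set X), TopologicalSpace.IsTopologicalBasis B ∧ #B = c}

/-! ### Transferring one almost disjoint family to another under Martin's axiom -/

section Transfer

variable {ι : Type u} {A B : ι → Set ℕ}

/-! Such a space consists of countably many isolated points, κ points of rank one (`mid`), and
finitely many points of rank two (`top`). Clopen neighbourhoods of the rank-one points trace an
almost disjoint family on ℕ. Let X be the space of functions vanishing at the rank-two points.
Evaluation at the rank-one points maps X to `ι → ℝ` with kernel c₀.

Martin's axiom compares any two such families `A`, `B` indexed by ι: it yields finite sets s n of
size at most 2 such that, for each i and almost all n, s n meets A i in one point if n ∈ B i and in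
none otherwise (`MartinAxiom.exists_transfer`). Summing a function over s n then gives a bounded
operator X₀ → X₁ that preserves the values at rank-one points (`exists_clm_of_transfer`). By
symmetry there is also one from X₁ to X₀.

Operators in both directions over the same quotient give X₀ × c₀ ≃ c₀ × X₁
(`nonempty_prod_ker_equiv_of_comp_eq`). A sequence converging to a rank-one point splits a copy of
c₀ off X. This copy absorbs both the finitely many rank-two values and one further c₀, so C(K) ≃ X ×
c₀ (`nonempty_equiv_cZero_prod`), and the two results combine. -/

theorem exists_mem_ge_forall_notMem (hinf : ∀ i, (A i).Infinite)
    (had : Pairwise fun i j => (A i ∩ A j).Finite) (H : Finset ι) (n : ℕ) (i : ι) :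
    ∃ k ∈ A i, n ≤ k ∧ ∀ j ∈ H, j ≠ i → k ∉ A j := by
  classical
  have hfin : (⋃ j ∈ H.erase i, A i ∩ A j).Finite :=
    (H.erase i).finite_toSet.biUnion fun j hj => had (Finset.ne_of_mem_erase hj).symm
  obtain ⟨k, hk, hk'⟩ := ((hinf i).sdiff (hfin.union (Set.finite_lt_nat n))).nonempty
  simp only [Set.mem_union, Set.mem_iUnion, Set.mem_inter_iff, Finset.mem_erase, Set.mem_ofPred_eq,
    not_or, not_exists, not_and, not_lt] at hk'
  exact ⟨k, hk, hk'.2, fun j hj hji hkj => hk'.1 j ⟨hji, hj⟩ hk hkj⟩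

open Classical in
-- Each of `F` and `G` demands a point for at most one index, and private points of those indices,
-- lying in no other A j for j ∈ F ∪ G, meet all demands. This is the source of the bound 2: `n` may
-- lie in one B i from `F` and in a different one from `G`.
theorem exists_finset_card_filter_eq (hinf : ∀ i, (A i).Infinite)
    (had : Pairwise fun i j => (A i ∩ A j).Finite) (F G : Finset ι) (n : ℕ)
    (hF : ∀ i ∈ F, ∀ j ∈ F, n ∈ B i → n ∈ B j → i = j)
    (hG : ∀ i ∈ G, ∀ j ∈ G, n ∈ B i → n ∈ B j → i = j) :
    ∃ t : Finset ℕ, t.card ≤ 2 ∧ (∀ k ∈ t, n ≤ k) ∧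
      ∀ i ∈ F ∪ G, (t.filter (· ∈ A i)).card = if n ∈ B i then 1 else 0 := by
  choose k hk hnk hkd using exists_mem_ge_forall_notMem hinf had (F ∪ G) n
  refine ⟨((F ∪ G).filter (n ∈ B ·)).image k, ?_, ?_, ?_⟩
  · have h1 : (F.filter (n ∈ B ·)).card ≤ 1 := Finset.card_le_one.2 fun i hi j hj => by
      rw [Finset.mem_filter] at hi hj
      exact hF i hi.1 j hj.1 hi.2 hj.2
    have h2 : (G.filter (n ∈ B ·)).card ≤ 1 := Finset.card_le_one.2 fun i hi j hj => by
      rw [Finset.mem_filter] at hi hj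
      exact hG i hi.1 j hj.1 hi.2 hj.2
    refine Finset.card_image_le.trans ?_
    rw [Finset.filter_union]
    exact (Finset.card_union_le _ _).trans (by omega)
  · intro m hm
    obtain ⟨i, -, rfl⟩ := Finset.mem_image.1 hm
    exact hnk i
  · intro i hi
    have key : ∀ j ∈ F ∪ G, k j ∈ A i ↔ j = i := fun j hj =>
      ⟨fun h => by_contra fun hne => hkd j i hi (Ne.symm hne) h, fun h => h ▸ hk j⟩
    split_ifs with h
    · rw [Finset.card_eq_one]
      refine ⟨k i, ?_⟩
      ext m
      simp only [Finset.mem_filter, Finset.mem_image, Finset.mem_singleton]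
      constructor
      · rintro ⟨⟨j, ⟨hj, -⟩, rfl⟩, hm⟩
        rw [(key j hj).1 hm]
      · rintro rfl
        exact ⟨⟨i, ⟨hi, h⟩, rfl⟩, hk i⟩
    · rw [Finset.card_eq_zero, Finset.filter_eq_empty_iff]
      intro m hm hmA
      obtain ⟨j, hj, rfl⟩ := Finset.mem_image.1 hm
      rw [Finset.mem_filter] at hj
      rw [(key j hj.1).1 hmA] at hj
      exact h hj.2

/-- A finite approximation to a transfer from the family `A` to the family `B`: the list holds the
sets attached to an initial segment of `ℕ`, and the finite set holds the indices at which later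
extensions have to be exact. -/
structure TransferCond (A B : ι → Set ℕ) : Type u where
  sets : List (Finset ℕ)
  active : Finset ι
  card_le : ∀ n, (sets.getD n ∅).card ≤ 2
  le_of_mem : ∀ n, ∀ k ∈ sets.getD n ∅, n ≤ k
  disjoint : ∀ i ∈ active, ∀ j ∈ active, ∀ n, sets.length ≤ n → n ∈ B i → n ∈ B j → i = j

namespace TransferCond

theorem getD_eq_of_prefix {α : Type*} {l l' : List α} (h : l <+: l') (d : α) {n : ℕ}
    (hn : n < l.length) : l'.getD n d = l.getD n d := by
  obtain ⟨t, rfl⟩ := h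
  rw [List.getD_append _ _ _ _ hn]

open Classical in
-- Exactness is required only on the newly added positions and only for indices that were already
-- active. Errors for an index are therefore confined to the positions filled before it became
-- active.
instance : PartialOrder (TransferCond A B) where
  le p q := q.sets <+: p.sets ∧ q.active ⊆ p.active ∧
    ∀ n, q.sets.length ≤ n → n < p.sets.length → ∀ i ∈ q.active,
      ((p.sets.getD n ∅).filter (· ∈ A i)).card = if n ∈ B i then 1 else 0
  le_refl p := ⟨List.prefix_rfl, Finset.Subset.refl _, fun n h h' => absurd h' (not_lt.2 h)⟩
  le_trans p q r hpq hqr := by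
    refine ⟨hqr.1.trans hpq.1, hqr.2.1.trans hpq.2.1, fun n h h' i hi => ?_⟩
    rcases lt_or_ge n q.sets.length with hn | hn
    · rw [getD_eq_of_prefix hpq.1 _ hn]
      exact hqr.2.2 n h hn i hi
    · exact hpq.2.2 n hn h' i (hqr.2.1 hi)
  le_antisymm p q hpq hqp := by
    have h1 : p.sets = q.sets := (List.IsPrefix.eq_of_length_le hqp.1 hpq.1.length_le)
    have h2 : p.active = q.active := Finset.Subset.antisymm hqp.2.1 hpq.2.1
    cases p; cases q; simp_all

open Classical in
theorem le_def {p q : TransferCond A B} : p ≤ q ↔ q.sets <+: p.sets ∧ q.active ⊆ p.active ∧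
    ∀ n, q.sets.length ≤ n → n < p.sets.length → ∀ i ∈ q.active,
      ((p.sets.getD n ∅).filter (· ∈ A i)).card = if n ∈ B i then 1 else 0 := by
  rfl

instance : Nonempty (TransferCond A B) :=
  ⟨⟨[], ∅, by simp, by simp, by simp⟩⟩

open Classical in
theorem exists_extend_sets (hinf : ∀ i, (A i).Infinite)
    (had : Pairwise fun i j => (A i ∩ A j).Finite) {p q : TransferCond A B}
    (h : p.sets = q.sets) (m : ℕ) :
    ∃ l : List (Finset ℕ), p.sets <+: l ∧ l.length = p.sets.length + m ∧
      (∀ n, (l.getD n ∅).card ≤ 2) ∧ (∀ n, ∀ k ∈ l.getD n ∅, n ≤ k) ∧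
      ∀ n, p.sets.length ≤ n → n < l.length → ∀ i ∈ p.active ∪ q.active,
        ((l.getD n ∅).filter (· ∈ A i)).card = if n ∈ B i then 1 else 0 := by
  induction m with
  | zero => exact ⟨p.sets, List.prefix_rfl, rfl, p.card_le, p.le_of_mem,
      fun n h h' => absurd h' (not_lt.2 h)⟩
  | succ m ih =>
    obtain ⟨l, hpl, hlen, hcard, hle, hex⟩ := ih
    obtain ⟨t, ht2, htn, htA⟩ := exists_finset_card_filter_eq (B := B) hinf had p.active q.active
      l.length (fun i hi j hj => p.disjoint i hi j hj _ (by omega))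
      (fun i hi j hj => q.disjoint i hi j hj _ (by rw [← h]; omega))
    have hget : ∀ n, (l ++ [t]).getD n ∅ = if n = l.length then t else l.getD n ∅ := by
      intro n
      rcases lt_trichotomy n l.length with hn | rfl | hn
      · rw [List.getD_append _ _ _ _ hn, if_neg hn.ne]
      · simp
      · rw [if_neg hn.ne', List.getD_eq_default _ _ hn.le, List.getD_eq_default]
        simpa using hn
    refine ⟨l ++ [t], hpl.trans (List.prefix_append _ _), by simp; omega, fun n => ?_,
      fun n => ?_, fun n hn hn' => ?_⟩
    · rw [hget]
      split_ifs
      exacts [ht2, hcard n]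
    · rw [hget]
      split_ifs with hn
      exacts [hn ▸ htn, hle n]
    · rw [hget]
      split_ifs with hnl
      · exact hnl ▸ htA
      · refine hex n hn ?_
        simp only [List.length_append, List.length_singleton] at hn'
        omega

/-- Amalgamation and density at once: conditions with the same list are compatible, and a common
extension may be made as long as desired and active at any given index. The case `p = q` gives
density. -/
theorem exists_le_le (hinf : ∀ i, (A i).Infinite)
    (hA : Pairwise fun i j => (A i ∩ A j).Finite) (hB : Pairwise fun i j => (B i ∩ B j).Finite)
    {p q : TransferCond A B} (h : p.sets = q.sets) (m : ℕ) (i : ι) :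
    ∃ r, r ≤ p ∧ r ≤ q ∧ m ≤ r.sets.length ∧ i ∈ r.active := by
  classical
  set F := insert i (p.active ∪ q.active) with hF
  have hfin : (⋃ z ∈ F.offDiag, B z.1 ∩ B z.2).Finite :=
    F.offDiag.finite_toSet.biUnion fun z hz => hB (Finset.mem_offDiag.1 hz).2.2
  obtain ⟨b, hb⟩ := hfin.bddAbove
  -- Past `b` the sets B j with j ∈ F are pairwise disjoint, so the list must end beyond `b` before
  -- all of `F` may become active; `m` is the requested length.
  obtain ⟨l, hpl, hlen, hcard, hle, hex⟩ := exists_extend_sets hinf hA h (m + b + 1)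
  refine ⟨⟨l, F, hcard, hle, fun j hj j' hj' n hn hnj hnj' => ?_⟩, ?_, ?_, ?_, ?_⟩
  · by_contra hne
    have : n ≤ b := hb (Set.mem_biUnion (x := (j, j'))
      (by simpa using ⟨hj, hj', hne⟩) ⟨hnj, hnj'⟩)
    omega
  · refine le_def.2 ⟨hpl, fun j hj => ?_, fun n hn hn' j hj =>
      hex n hn hn' j (Finset.mem_union_left _ hj)⟩
    exact Finset.mem_insert_of_mem (Finset.mem_union_left _ hj)
  · refine le_def.2 ⟨h ▸ hpl, fun j hj => ?_, fun n hn hn' j hj =>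
      hex n (h ▸ hn) hn' j (Finset.mem_union_right _ hj)⟩
    exact Finset.mem_insert_of_mem (Finset.mem_union_right _ hj)
  · change m ≤ l.length
    omega
  · exact Finset.mem_insert_self _ _

theorem countableChainCondition [Nonempty ι] (hinf : ∀ i, (A i).Infinite)
    (hA : Pairwise fun i j => (A i ∩ A j).Finite)
    (hB : Pairwise fun i j => (B i ∩ B j).Finite) :
    CountableChainCondition (TransferCond A B) := by
  intro S hS
  -- Conditions with equal lists are compatible, and there are only countably many lists of finite
  -- subsets of ℕ.
  refine Set.countable_of_injective_of_countable_image (f := TransferCond.sets) ?_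
    (Set.to_countable _)
  intro p hp q hq hpq
  by_contra hne
  obtain ⟨r, hrp, hrq, -⟩ := exists_le_le hinf hA hB hpq 0 (Classical.arbitrary ι)
  exact hS hp hq hne ⟨r, hrp, hrq⟩

end TransferCond

open Classical in
/-- Under Martin's axiom, two almost disjoint families with the same index set are related by a
sequence of finite sets of size at most two that eventually meets the `i`-th set of the first
family in exactly one point along the `i`-th set of the second, and in no point off it. -/
theorem MartinAxiom.exists_transfer [Infinite ι] (hMA : MartinAxiom #ι)
    (hinf : ∀ i, (A i).Infinite)
    (hA : Pairwise fun i j => (A i ∩ A j).Finite) (hB : Pairwise fun i j => (B i ∩ B j).Finite) :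
    ∃ s : ℕ → Finset ℕ, (∀ n, (s n).card ≤ 2) ∧ (∀ n, ∀ k ∈ s n, n ≤ k) ∧
      ∀ i, ∃ n₀, ∀ n, n₀ ≤ n → ((s n).filter (· ∈ A i)).card = if n ∈ B i then 1 else 0 := by
  let D : ι × ULift.{u} ℕ → Set (TransferCond A B) :=
    fun z => {p | z.2.down ≤ p.sets.length ∧ z.1 ∈ p.active}
  obtain ⟨G, hG⟩ := hMA (TransferCond A B)
    (TransferCond.countableChainCondition hinf hA hB) (Set.range D)
    (by
      refine mk_range_le.trans ?_
      rw [mk_prod, Cardinal.lift_id, Cardinal.lift_id, mk_uLift, mk_nat, Cardinal.lift_aleph0]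
      exact (mul_aleph0_eq (aleph0_le_mk ι)).le)
    (by
      rintro _ ⟨z, rfl⟩ p
      obtain ⟨r, hrp, -, hr⟩ := TransferCond.exists_le_le hinf hA hB (rfl : p.sets = p.sets)
        z.2.down z.1
      exact ⟨r, hr, hrp⟩)
  have hG' : ∀ (i : ι) (m : ℕ), ∃ p ∈ G, m ≤ p.sets.length ∧ i ∈ p.active := fun i m => by
    obtain ⟨p, hp, hp'⟩ := hG _ ⟨(i, ⟨m⟩), rfl⟩
    exact ⟨p, hp, hp'⟩
  -- Length at least `m + 1` ensures that position `m` holds a genuine entry, not the default ∅.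
  -- Members of the filter agree wherever both lists are defined, so the choice of `p` is
  -- immaterial.
  choose p hpG hplen _ using fun m => hG' (Classical.arbitrary ι) (m + 1)
  refine ⟨fun n => (p n).sets.getD n ∅, fun n => (p n).card_le n, fun n => (p n).le_of_mem n,
    fun i => ?_⟩
  obtain ⟨q, hqG, -, hqi⟩ := hG' i 0
  refine ⟨q.sets.length, fun n hn => ?_⟩
  obtain ⟨r, -, hrp, hrq⟩ := G.directed (p n) (hpG n) q hqG
  have hlt : n < (p n).sets.length := hplen n
  have hpr := (TransferCond.le_def.1 hrp).1
  have := (TransferCond.le_def.1 hrq).2.2 n hn (hlt.trans_le hpr.length_le) i hqi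
  rwa [TransferCond.getD_eq_of_prefix hpr _ hlt] at this

end Transfer

/-! ### The structure of separable compact spaces of height three -/

/-- A presentation of a space as countably many isolated points, points of rank one indexed by `ι`
each with a clopen neighbourhood consisting otherwise of isolated points, and points of rank two
indexed by `Φ`. -/
structure ThreeLevels (K : Type u) [TopologicalSpace K] (ι Φ : Type u) where
  pt : ℕ ⊕ ι ⊕ Φ ≃ K
  nbhd : ι → Set K
  isOpen_singleton : ∀ n, IsOpen {pt (.inl n)}
  isClopen_nbhd : ∀ i, IsClopen (nbhd i)
  infinite_nbhd : ∀ i, (nbhd i).Infinite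
  mid_mem_nbhd_iff : ∀ i j, pt (.inr (.inl j)) ∈ nbhd i ↔ j = i
  top_notMem_nbhd : ∀ i p, pt (.inr (.inr p)) ∉ nbhd i

section Height

variable {K : Type u} [TopologicalSpace K]

theorem notMem_derivedSet_univ_iff {x : K} : x ∉ derivedSet (univ : Set K) ↔ IsOpen {x} := by
  rw [mem_derivedSet, isOpen_singleton_iff_punctured_nhds, AccPt, Filter.principal_univ, inf_top_eq,
    Filter.not_neBot]

theorem Set.Finite.derivedSet_eq_empty [T1Space K] {s : Set K} (hs : s.Finite) :
    derivedSet s = ∅ := by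
  by_contra h
  obtain ⟨x, hx⟩ := Set.nonempty_iff_ne_empty.2 h
  exact Set.Infinite.of_accPt (mem_derivedSet.1 hx) hs

theorem HasHeight.derivedSet_three [T1Space K] (h : HasHeight K 3) :
    derivedSet (derivedSet (derivedSet (univ : Set K))) = ∅ ∧
      (derivedSet (derivedSet (univ : Set K))).Nonempty := by
  have h1 : CantorBendixson.iteratedDerivedSet (univ : Set K) 1 = derivedSet univ := by
    rw [← zero_add 1, CantorBendixson.iteratedDerivedSet_succ,
      CantorBendixson.iteratedDerivedSet_zero, isClosed_univ.relDerivedSet_eq]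
  have h2 : CantorBendixson.iteratedDerivedSet (univ : Set K) 2 = derivedSet (derivedSet univ) := by
    rw [← one_add_one_eq_two, CantorBendixson.iteratedDerivedSet_succ, h1,
      (isClosed_derivedSet _).relDerivedSet_eq]
  have h3 : CantorBendixson.iteratedDerivedSet (univ : Set K) 3 =
      derivedSet (derivedSet (derivedSet univ)) := by
    rw [← two_add_one_eq_three, CantorBendixson.iteratedDerivedSet_succ, h2,
      (isClosed_derivedSet _).relDerivedSet_eq]
  refine ⟨h3 ▸ h.1, Set.nonempty_iff_ne_empty.2 fun he => ?_⟩
  have := h.2 (show CantorBendixson.iteratedDerivedSet (univ : Set K) 2 = ∅ from h2.trans he)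
  exact absurd this (by norm_num)

theorem exists_isClopen_inter_derivedSet [T2Space K] [CompactSpace K] {x : K}
    (hx : x ∈ derivedSet (univ : Set K)) (hx' : x ∉ derivedSet (derivedSet (univ : Set K))) :
    ∃ U : Set K, IsClopen U ∧ U ∩ derivedSet univ = {x} := by
  rw [mem_derivedSet, accPt_iff_nhds] at hx'
  push Not at hx'
  obtain ⟨V, hV, hVx⟩ := hx'
  obtain ⟨U, hU, hUc, hUV⟩ := exists_mem_nhds_isClosed_subset hV
  -- A closed neighbourhood of `x` meeting the derived set only in `x` is automatically open,
  -- because its other points are isolated.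
  refine ⟨U, ⟨hUc, isOpen_iff_mem_nhds.2 fun y hy => ?_⟩, ?_⟩
  · by_cases hyd : y ∈ derivedSet (univ : Set K)
    · rwa [hVx y ⟨hUV hy, hyd⟩]
    · exact Filter.mem_of_superset ((notMem_derivedSet_univ_iff.1 hyd).mem_nhds rfl)
        (by simpa using hy)
  · ext y
    exact ⟨fun hy => hVx y ⟨hUV hy.1, hy.2⟩, fun hy => by
      rw [Set.mem_singleton_iff.1 hy]
      exact ⟨mem_of_mem_nhds hU, hx⟩⟩

theorem countable_compl_derivedSet_univ [TopologicalSpace.SeparableSpace K] :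
    ((derivedSet (univ : Set K))ᶜ).Countable := by
  obtain ⟨t, htc, htd⟩ := TopologicalSpace.exists_countable_dense K
  refine htc.mono fun x hx => ?_
  obtain ⟨y, hy, hyt⟩ := htd.inter_open_nonempty _ (notMem_derivedSet_univ_iff.1 hx) ⟨x, rfl⟩
  rwa [← Set.mem_singleton_iff.1 hy]

theorem TopologicalSpace.eq_of_le_of_compactSpace_of_t2Space {X : Type*}
    {t t' : TopologicalSpace X} (h : t ≤ t') [@CompactSpace X t] [@T2Space X t'] : t = t' := by
  refine le_antisymm h fun U hU => ?_
  have hc : @IsCompact X t Uᶜ :=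
    @IsClosed.isCompact X t _ _ (@isClosed_compl_iff X t _ |>.2 hU)
  have hc' : @IsCompact X t' Uᶜ := by
    simpa using @IsCompact.image X X t t' _ id hc (@continuous_id_iff_le X t t' |>.2 h)
  exact @isClosed_compl_iff X t' _ |>.1 (@IsCompact.isClosed X t' _ _ hc')

/-- Open sets separating pairs of points generate a coarser Hausdorff topology, which by compactness
is the original one. Finite intersections of these sets form a base of size at most `#K`. -/
theorem topWeight_le_mk [CompactSpace K] [T2Space K] [Infinite K] : topWeight K ≤ #K := by
  classical
  have hsep : ∀ z : K × K, ∃ u v : Set K, IsOpen u ∧ IsOpen v ∧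
      (z.1 ≠ z.2 → z.1 ∈ u ∧ z.2 ∈ v ∧ Disjoint u v) := fun z => by
    by_cases h : z.1 = z.2
    · exact ⟨∅, ∅, isOpen_empty, isOpen_empty, fun h' => absurd h h'⟩
    · obtain ⟨u, v, hu, hv, h1, h2, h3⟩ := t2_separation h
      exact ⟨u, v, hu, hv, fun _ => ⟨h1, h2, h3⟩⟩
  choose u v hu hv huv using hsep
  let w : (K × K) ⊕ (K × K) → Set K := Sum.elim u v
  have hle : ‹TopologicalSpace K› ≤ TopologicalSpace.generateFrom (range w) := by
    refine le_generateFrom ?_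
    rintro _ ⟨z | z, rfl⟩
    exacts [hu z, hv z]
  have hT2 : @T2Space K (TopologicalSpace.generateFrom (range w)) := by
    refine @T2Space.mk K (_) fun x y hxy => ?_
    obtain ⟨h1, h2, h3⟩ := huv (x, y) hxy
    exact ⟨u (x, y), v (x, y), TopologicalSpace.isOpen_generateFrom_of_mem ⟨.inl (x, y), rfl⟩,
      TopologicalSpace.isOpen_generateFrom_of_mem ⟨.inr (x, y), rfl⟩, h1, h2, h3⟩
  have hbasis := TopologicalSpace.isTopologicalBasis_of_subbasis
    (TopologicalSpace.eq_of_le_of_compactSpace_of_t2Space hle)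
  have hle' : topWeight K ≤ #((fun f => ⋂₀ f) '' {f : Set (Set K) | f.Finite ∧ f ⊆ range w}) :=
    csInf_le' ⟨_, hbasis, rfl⟩
  refine hle'.trans ?_
  have hsub : (fun f => ⋂₀ f) '' {f : Set (Set K) | f.Finite ∧ f ⊆ range w} ⊆
      range fun t : Finset ((K × K) ⊕ (K × K)) => ⋂₀ (w '' t) := by
    rintro _ ⟨f, ⟨hf, hfw⟩, rfl⟩
    obtain ⟨t, -, ht, hte⟩ := (Set.exists_subset_image_finite_and (f := w) (s := univ)
      (p := fun t => t = f)).1 ⟨f, by rwa [Set.image_univ], hf, rfl⟩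
    exact ⟨ht.toFinset, by simp [hte]⟩
  refine (mk_le_mk_of_subset hsub).trans (mk_range_le.trans ?_)
  rw [mk_finset_of_infinite, mk_sum, mk_prod, Cardinal.lift_id, Cardinal.lift_id,
    mul_eq_self (aleph0_le_mk K), add_eq_self (aleph0_le_mk K)]

theorem mk_le_topWeight {s : Set K} (U : K → Set K) (hU : ∀ x ∈ s, IsOpen (U x))
    (hUs : ∀ x ∈ s, U x ∩ s = {x}) : #s ≤ topWeight K := by
  obtain ⟨B, hB, hBc⟩ := csInf_mem (s := {c : Cardinal.{u} |
    ∃ B : Set (Set K), TopologicalSpace.IsTopologicalBasis B ∧ #B = c})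
    ⟨_, _, TopologicalSpace.isTopologicalBasis_opens, rfl⟩
  have hmem : ∀ x ∈ s, x ∈ U x := fun x hx => by
    have : x ∈ U x ∩ s := by rw [hUs x hx]; rfl
    exact this.1
  choose O hOB hxO hOU using fun x : s =>
    hB.exists_subset_of_mem_open (hmem x x.2) (hU x x.2)
  rw [topWeight, ← hBc]
  refine mk_le_of_injective (f := fun x : s => (⟨O x, hOB x⟩ : B)) fun x y hxy => ?_
  have hO : O x = O y := congrArg Subtype.val hxy
  have : (x : K) ∈ U y ∩ s := ⟨hOU y (hO ▸ hxO x), x.2⟩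
  rw [hUs y y.2] at this
  exact Subtype.ext this

variable [CompactSpace K] [T2Space K] [TopologicalSpace.SeparableSpace K]

/-- By compactness the last nonempty derived set is finite, and the rank-one level is infinite since
otherwise the second derived set would be empty. The weight equals the size of the rank-one level:
that level is discrete, and all other points are countable in number. -/
theorem HasHeight.aleph0_le_topWeight_and_exists_threeLevels (h : HasHeight K 3) :
    ℵ₀ ≤ topWeight K ∧ ∀ ι : Type u, #ι = topWeight K →
      ∃ Φ : Type u, Finite Φ ∧ Nonempty (ThreeLevels K ι Φ) := by
  obtain ⟨h3, h2⟩ := h.derivedSet_three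
  set D := derivedSet (univ : Set K) with hD
  have hDc : IsClosed D := isClosed_derivedSet _
  have hDD : derivedSet D ⊆ D := (isClosed_iff_derivedSet_subset D).1 hDc
  have hfin : (derivedSet D).Finite := by
    by_contra hinf
    obtain ⟨x, hx⟩ := Set.Infinite.exists_accPt_principal hinf
    exact (h3 ▸ (mem_derivedSet.2 hx) : x ∈ (∅ : Set K))
  have hLinf : (D \ derivedSet D).Infinite := fun hL => by
    have : D.Finite := (hL.union hfin).subset fun x hx => by
      by_cases hx' : x ∈ derivedSet D
      exacts [Or.inr hx', Or.inl ⟨hx, hx'⟩]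
    rw [this.derivedSet_eq_empty] at h2
    exact Set.not_nonempty_empty h2
  have hU : ∀ x : K, ∃ U : Set K, x ∈ D \ derivedSet D → IsClopen U ∧ U ∩ D = {x} := fun x => by
    by_cases hx : x ∈ D \ derivedSet D
    · obtain ⟨U, hU⟩ := exists_isClopen_inter_derivedSet hx.1 hx.2
      exact ⟨U, fun _ => hU⟩
    · exact ⟨∅, fun h => absurd h hx⟩
  choose U hU using hU
  have hxU : ∀ x ∈ D \ derivedSet D, x ∈ U x := fun x hx => by
    have : x ∈ U x ∩ D := by rw [(hU x hx).2]; rfl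
    exact this.1
  have hUinf : ∀ x ∈ D \ derivedSet D, (U x).Infinite := fun x hx => by
    have hne : (𝓝[≠] x).NeBot := by
      have := hx.1
      rwa [hD, mem_derivedSet, AccPt, Filter.principal_univ, inf_top_eq] at this
    exact infinite_of_mem_nhds x ((hU x hx).1.isOpen.mem_nhds (hxU x hx))
  have hNc : (Dᶜ).Countable := countable_compl_derivedSet_univ
  have hNinf : (Dᶜ).Infinite := fun hN => by
    obtain ⟨x, hx⟩ := hLinf.nonempty
    refine hUinf x hx ((hN.union (Set.finite_singleton x)).subset fun y hy => ?_)
    by_cases hyD : y ∈ D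
    · exact Or.inr ((hU x hx).2 ▸ ⟨hy, hyD⟩)
    · exact Or.inl hyD
  have hLa : ℵ₀ ≤ #(D \ derivedSet D : Set K) := by
    have := hLinf.to_subtype
    exact aleph0_le_mk _
  have hcard : #(D \ derivedSet D : Set K) = topWeight K := by
    refine le_antisymm (mk_le_topWeight U (fun x hx => (hU x hx).1.isOpen) fun x hx => ?_) ?_
    · refine Set.Subset.antisymm (fun y hy => (hU x hx).2 ▸ ⟨hy.1, hy.2.1⟩) ?_
      rintro y rfl
      exact ⟨hxU y hx, hx⟩
    · have : Infinite K := Set.infinite_univ_iff.1 (hLinf.mono (Set.subset_univ _))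
      refine topWeight_le_mk.trans ?_
      have huniv : (univ : Set K) ⊆ (D \ derivedSet D) ∪ (Dᶜ ∪ derivedSet D) := fun x _ => by
        by_cases h1 : x ∈ D <;> by_cases h2 : x ∈ derivedSet D <;> simp [h1, h2]
      rw [← mk_univ]
      refine (mk_le_mk_of_subset huniv).trans ((mk_union_le _ _).trans ?_)
      refine (add_le_add le_rfl ((le_aleph0_iff_set_countable.2
        (hNc.union hfin.countable)).trans hLa)).trans ?_
      rw [add_eq_self hLa]
  refine ⟨hcard ▸ hLa, fun ι hι => ?_⟩
  obtain ⟨eL⟩ := Cardinal.eq.1 (hι.trans hcard.symm)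
  have := hNc.to_subtype
  have := hNinf.to_subtype
  obtain ⟨eN⟩ := nonempty_equiv_of_countable (α := ℕ) (β := (Dᶜ : Set K))
  let g : ℕ ⊕ ι ⊕ (derivedSet D : Set K) → K :=
    Sum.elim (fun n => eN n) (Sum.elim (fun i => eL i) Subtype.val)
  have hg : Function.Bijective g := by
    constructor
    · have hN : ∀ n, (eN n : K) ∉ D := fun n => (eN n).2
      have hL : ∀ i, (eL i : K) ∈ D := fun i => (eL i).2.1
      have hL' : ∀ i, (eL i : K) ∉ derivedSet D := fun i => (eL i).2.2
      refine Function.Injective.sumElim (Subtype.val_injective.comp eN.injective)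
        (Function.Injective.sumElim (Subtype.val_injective.comp eL.injective)
          Subtype.val_injective fun i p hip => hL' i (hip ▸ p.2)) ?_
      rintro n (i | p) hnp
      · exact hN n (hnp ▸ hL i)
      · exact hN n (hnp ▸ hDD p.2)
    · intro x
      by_cases h1 : x ∈ D
      · by_cases h2 : x ∈ derivedSet D
        · exact ⟨.inr (.inr ⟨x, h2⟩), rfl⟩
        · exact ⟨.inr (.inl (eL.symm ⟨x, h1, h2⟩)), by simp [g]⟩
      · exact ⟨.inl (eN.symm ⟨x, h1⟩), by simp [g]⟩
  refine ⟨(derivedSet D : Set K), hfin.to_subtype, ⟨{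
    pt := Equiv.ofBijective g hg
    nbhd := fun i => U (eL i)
    isOpen_singleton := fun n => notMem_derivedSet_univ_iff.1 (eN n).2
    isClopen_nbhd := fun i => (hU _ (eL i).2).1
    infinite_nbhd := fun i => hUinf _ (eL i).2
    mid_mem_nbhd_iff := fun i j => ⟨fun hj => ?_, fun hj => ?_⟩
    top_notMem_nbhd := fun i p hp => ?_ }⟩⟩
  · have : (eL j : K) ∈ U (eL i) ∩ D := ⟨hj, (eL j).2.1⟩
    rw [(hU _ (eL i).2).2] at this
    exact eL.injective (Subtype.ext this)
  · subst hj
    exact hxU _ (eL j).2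
  · have : (p : K) ∈ U (eL i) ∩ D := ⟨hp, hDD p.2⟩
    rw [(hU _ (eL i).2).2] at this
    exact (eL i).2.2 ((Set.mem_singleton_iff.1 this) ▸ p.2)

end Height

/-! ### The Banach space `c₀` -/

section CZero

open Filter ZeroAtInfty

variable {E : Type*} [NormedAddCommGroup E] [NormedSpace ℝ E]

theorem ZeroAtInftyContinuousMap.norm_apply_le (f : C₀(ℕ, ℝ)) (n : ℕ) : ‖f n‖ ≤ ‖f‖ :=
  f.toBCF.norm_coe_le_norm n

theorem ZeroAtInftyContinuousMap.tendsto_cofinite (f : C₀(ℕ, ℝ)) :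
    Tendsto f cofinite (𝓝 0) := by
  rw [← cocompact_eq_cofinite]
  exact f.zero_at_infty'

/-- Evaluation at a natural number on `c₀`. -/
noncomputable def evalCZero (n : ℕ) : C₀(ℕ, ℝ) →L[ℝ] ℝ :=
  LinearMap.mkContinuous ⟨⟨fun f => f n, fun _ _ => rfl⟩, fun _ _ => rfl⟩ 1
    fun f => by simpa using f.norm_apply_le n

@[simp]
theorem evalCZero_apply (n : ℕ) (f : C₀(ℕ, ℝ)) : evalCZero n f = f n := rfl

/-- A bounded pointwise null sequence of functionals is an operator into `c₀`. -/
theorem exists_clm_cZero (φ : ℕ → E →L[ℝ] ℝ) (C : ℝ) (hC : ∀ j f, ‖φ j f‖ ≤ C * ‖f‖)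
    (h0 : ∀ f, Tendsto (fun j => φ j f) cofinite (𝓝 0)) :
    ∃ P : E →L[ℝ] C₀(ℕ, ℝ), ∀ f j, P f j = φ j f := by
  let P : E →ₗ[ℝ] C₀(ℕ, ℝ) :=
    { toFun := fun f => ⟨⟨fun j => φ j f, continuous_of_discreteTopology⟩, by
        rw [cocompact_eq_cofinite]
        exact h0 f⟩
      map_add' := fun f g => by ext j; exact map_add (φ j) f g
      map_smul' := fun c f => by ext j; exact map_smul (φ j) c f }
  refine ⟨P.mkContinuous (max C 0) fun f => ?_, fun f j => rfl⟩
  rw [← ZeroAtInftyContinuousMap.norm_toBCF_eq_norm]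
  refine (BoundedContinuousFunction.norm_le (by positivity)).2 fun j => ?_
  exact (hC j f).trans (by gcongr; exact le_max_left _ _)

theorem tendsto_sumElim_cofinite {α β : Type*} {f : α → ℝ} {g : β → ℝ}
    (hf : Tendsto f cofinite (𝓝 0)) (hg : Tendsto g cofinite (𝓝 0)) :
    Tendsto (Sum.elim f g) cofinite (𝓝 0) := by
  intro s hs
  have h1 := (mem_cofinite.1 (hf hs)).image (Sum.inl (β := β))
  have h2 := (mem_cofinite.1 (hg hs)).image (Sum.inr (α := α))
  refine mem_cofinite.2 ((h1.union h2).subset ?_)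
  rintro (a | b) h
  exacts [Or.inl ⟨a, h, rfl⟩, Or.inr ⟨b, h, rfl⟩]

theorem nonempty_cZero_prod_self_equiv : Nonempty ((C₀(ℕ, ℝ) × C₀(ℕ, ℝ)) ≃L[ℝ] C₀(ℕ, ℝ)) := by
  obtain ⟨e⟩ := nonempty_equiv_of_countable (α := ℕ ⊕ ℕ) (β := ℕ)
  obtain ⟨P, hP⟩ := exists_clm_cZero (E := C₀(ℕ, ℝ) × C₀(ℕ, ℝ))
    (fun j => Sum.elim (fun n => (evalCZero n).comp (.fst ℝ _ _))
      (fun n => (evalCZero n).comp (.snd ℝ _ _)) (e.symm j)) 1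
    (fun j f => by
      rcases e.symm j with n | n
      · simpa using (f.1.norm_apply_le n).trans (norm_fst_le f)
      · simpa using (f.2.norm_apply_le n).trans (norm_snd_le f))
    (fun f => by
      refine Tendsto.congr (fun j => ?_) ((tendsto_sumElim_cofinite f.1.tendsto_cofinite
        f.2.tendsto_cofinite).comp e.symm.injective.tendsto_cofinite)
      rw [Function.comp_apply]
      rcases e.symm j with n | n <;> rfl)
  have hQ : ∀ a : ℕ → ℕ, Function.Injective a →
      ∃ Q : C₀(ℕ, ℝ) →L[ℝ] C₀(ℕ, ℝ), ∀ f j, Q f j = evalCZero (a j) f := fun a ha =>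
    exists_clm_cZero _ 1 (fun j f => by simpa using f.norm_apply_le _)
      fun f => f.tendsto_cofinite.comp ha.tendsto_cofinite
  obtain ⟨Q₁, hQ₁⟩ := hQ (fun n => e (.inl n)) (e.injective.comp Sum.inl_injective)
  obtain ⟨Q₂, hQ₂⟩ := hQ (fun n => e (.inr n)) (e.injective.comp Sum.inr_injective)
  refine ⟨ContinuousLinearEquiv.equivOfInverse P (Q₁.prod Q₂) (fun f => ?_) fun f => ?_⟩
  · refine Prod.ext ?_ ?_ <;> ext n <;> simp [hQ₁, hQ₂, hP]
  · ext j
    obtain ⟨z, rfl⟩ := e.surjective j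
    rcases z with n | n <;> simp [hP, hQ₁, hQ₂]

theorem nonempty_pi_prod_cZero_equiv (Φ : Type*) [Fintype Φ] :
    Nonempty (((Φ → ℝ) × C₀(ℕ, ℝ)) ≃L[ℝ] C₀(ℕ, ℝ)) := by
  obtain ⟨e⟩ := nonempty_equiv_of_countable (α := Φ ⊕ ℕ) (β := ℕ)
  obtain ⟨P, hP⟩ := exists_clm_cZero (E := (Φ → ℝ) × C₀(ℕ, ℝ))
    (fun j => Sum.elim (fun p => (ContinuousLinearMap.proj p).comp (.fst ℝ _ _))
      (fun n => (evalCZero n).comp (.snd ℝ _ _)) (e.symm j)) 1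
    (fun j f => by
      rcases e.symm j with n | n
      · simpa using (norm_le_pi_norm f.1 n).trans (norm_fst_le f)
      · simpa using (f.2.norm_apply_le n).trans (norm_snd_le f))
    (fun f => by
      refine Tendsto.congr (fun j => ?_) ((tendsto_sumElim_cofinite (f := f.1)
        (by simp [cofinite_eq_bot])
        f.2.tendsto_cofinite).comp e.symm.injective.tendsto_cofinite)
      rw [Function.comp_apply]
      rcases e.symm j with n | n <;> rfl)
  obtain ⟨Q, hQ⟩ := exists_clm_cZero (fun n => evalCZero (e (.inr n))) 1
    (fun j f => by simpa using f.norm_apply_le _)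
    fun f => f.tendsto_cofinite.comp (e.injective.comp Sum.inr_injective).tendsto_cofinite
  refine ⟨ContinuousLinearEquiv.equivOfInverse P
    ((ContinuousLinearMap.pi fun p => evalCZero (e (.inl p))).prod Q) (fun f => ?_) fun f => ?_⟩
  · refine Prod.ext ?_ ?_
    · ext n; simp [hP]
    · ext n; simp [hP, hQ]
  · ext j
    obtain ⟨z, rfl⟩ := e.surjective j
    rcases z with n | n <;> simp [hP, hQ]

end CZero

/-! ### Two extensions over a common quotient -/

section Pullback

variable {X Y V : Type*} [NormedAddCommGroup X] [NormedSpace ℝ X] [NormedAddCommGroup Y]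
  [NormedSpace ℝ Y] [AddCommGroup V] [Module ℝ V] [TopologicalSpace V]

/-- Two extensions that map to each other over the same quotient are isomorphic after adding each
other's kernel. -/
theorem nonempty_prod_ker_equiv_of_comp_eq (q : X →L[ℝ] V) (q' : Y →L[ℝ] V) (T : X →L[ℝ] Y)
    (R : Y →L[ℝ] X) (hT : ∀ x, q' (T x) = q x) (hR : ∀ y, q (R y) = q' y) :
    Nonempty ((X × q'.ker) ≃L[ℝ] (q.ker × Y)) := by
  let y : X × q'.ker →L[ℝ] Y := T.comp (.fst ℝ _ _) + q'.ker.subtypeL.comp (.snd ℝ _ _)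
  let x : q.ker × Y →L[ℝ] X := q.ker.subtypeL.comp (.fst ℝ _ _) + R.comp (.snd ℝ _ _)
  have hy : ∀ z, y z = T z.1 + z.2 := fun z => rfl
  have hx : ∀ z, x z = z.1 + R z.2 := fun z => rfl
  have hk : ∀ v : q.ker, q (v : X) = 0 := fun v => v.2
  have hk' : ∀ v : q'.ker, q' (v : Y) = 0 := fun v => v.2
  -- The map is (x, k') ↦ (x - R y, y) with y = T x + k', and its inverse is (k, y) ↦ (x, y - T x)
  -- with x = k + R y. Neither quotient map needs to be surjective.
  refine ⟨ContinuousLinearEquiv.equivOfInverse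
    (((ContinuousLinearMap.fst ℝ X q'.ker - R.comp y).codRestrict q.ker fun z => ?_).prod y)
    (x.prod ((ContinuousLinearMap.snd ℝ q.ker Y - T.comp x).codRestrict q'.ker fun z => ?_))
    (fun z => ?_) fun z => ?_⟩
  · simp [hy, hT, hR, hk']
  · simp [hx, hT, hR, hk]
  · refine Prod.ext ?_ (Subtype.ext ?_)
    · simp [hx]
    · simp [hx, hy]
  · refine Prod.ext (Subtype.ext ?_) ?_
    · simp [hx, hy]
    · simp [hy]

end Pullback

/-! ### Continuous functions on a space with three levels -/

/-- The indicator function of a clopen set. -/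
noncomputable def clopenIndicator {K : Type*} [TopologicalSpace K] {U : Set K} (hU : IsClopen U) :
    C(K, ℝ) :=
  ⟨U.indicator 1, continuous_one.indicator (by simp [hU.frontier_eq])⟩

@[simp]
theorem clopenIndicator_apply {K : Type*} [TopologicalSpace K] {U : Set K} (hU : IsClopen U)
    (z : K) : clopenIndicator hU z = U.indicator 1 z := rfl

namespace ThreeLevels

open Filter ZeroAtInfty

variable {K : Type u} [TopologicalSpace K] {ι Φ : Type u} (d : ThreeLevels K ι Φ)

/-- The isolated points. -/
def isol (n : ℕ) : K := d.pt (.inl n)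

/-- The points of rank one. -/
def mid (i : ι) : K := d.pt (.inr (.inl i))

/-- The points of rank two. -/
def top (p : Φ) : K := d.pt (.inr (.inr p))

theorem cases_pt {P : K → Prop} (h₀ : ∀ n, P (d.isol n)) (h₁ : ∀ i, P (d.mid i))
    (h₂ : ∀ p, P (d.top p)) (z : K) : P z := by
  obtain ⟨n | i | p, rfl⟩ := d.pt.surjective z
  exacts [h₀ n, h₁ i, h₂ p]

theorem isol_injective : Function.Injective d.isol :=
  d.pt.injective.comp Sum.inl_injective

theorem top_injective : Function.Injective d.top :=
  d.pt.injective.comp (Sum.inr_injective.comp Sum.inr_injective)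

@[simp]
theorem mid_ne_isol (i : ι) (n : ℕ) : d.mid i ≠ d.isol n := d.pt.injective.ne (by simp)

@[simp]
theorem top_ne_isol (p : Φ) (n : ℕ) : d.top p ≠ d.isol n := d.pt.injective.ne (by simp)

@[simp]
theorem mid_mem_nbhd (i j : ι) : d.mid j ∈ d.nbhd i ↔ j = i := d.mid_mem_nbhd_iff i j

@[simp]
theorem top_notMem (i : ι) (p : Φ) : d.top p ∉ d.nbhd i := d.top_notMem_nbhd i p

theorem isOpen_isol (n : ℕ) : IsOpen {d.isol n} := d.isOpen_singleton n

theorem isClopen_isol [T1Space K] (n : ℕ) : IsClopen {d.isol n} :=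
  ⟨isClosed_singleton, d.isOpen_isol n⟩

/-- The function with prescribed values on the three levels. -/
noncomputable def ofLevels (a : ℕ → ℝ) (b : ι → ℝ) (c : Φ → ℝ) (z : K) : ℝ :=
  Sum.elim a (Sum.elim b c) (d.pt.symm z)

@[simp]
theorem ofLevels_isol (a : ℕ → ℝ) (b : ι → ℝ) (c : Φ → ℝ) (n : ℕ) :
    d.ofLevels a b c (d.isol n) = a n := by simp [ofLevels, isol]

@[simp]
theorem ofLevels_mid (a : ℕ → ℝ) (b : ι → ℝ) (c : Φ → ℝ) (i : ι) :
    d.ofLevels a b c (d.mid i) = b i := by simp [ofLevels, mid]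

@[simp]
theorem ofLevels_top (a : ℕ → ℝ) (b : ι → ℝ) (c : Φ → ℝ) (p : Φ) :
    d.ofLevels a b c (d.top p) = c p := by simp [ofLevels, top]

theorem finite_of_isCompact_subset_range {C : Set K} (hC : IsCompact C)
    (hsub : C ⊆ range d.isol) : {n | d.isol n ∈ C}.Finite := by
  obtain ⟨t, ht⟩ := hC.elim_finite_subcover (fun n => {d.isol n}) d.isOpen_isol fun z hz => by
    obtain ⟨n, rfl⟩ := hsub hz
    exact mem_iUnion.2 ⟨n, rfl⟩
  refine t.finite_toSet.subset fun n hn => ?_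
  obtain ⟨m, hm, hnm⟩ := mem_iUnion₂.1 (ht hn)
  rwa [d.isol_injective hnm]

theorem finite_mid_mem {C : Set K} (hC : IsCompact C) (htop : ∀ p, d.top p ∉ C) :
    {i | d.mid i ∈ C}.Finite := by
  classical
  obtain ⟨t, ht⟩ := hC.elim_finite_subcover (Sum.elim (fun n => {d.isol n}) d.nbhd)
    (by
      rintro (n | i)
      exacts [d.isOpen_isol n, (d.isClopen_nbhd i).isOpen])
    (fun z => d.cases_pt (P := fun z => z ∈ C → _) (fun n _ => mem_iUnion.2 ⟨.inl n, rfl⟩)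
      (fun i _ => mem_iUnion.2 ⟨.inr i, by simp⟩) (fun p hp => absurd hp (htop p)) z)
  refine (t.finite_toSet.preimage (f := Sum.inr) Sum.inr_injective.injOn).subset fun i hi => ?_
  obtain ⟨n | j, hm, him⟩ := mem_iUnion₂.1 (ht hi)
  · exact absurd him (by simp)
  · have : i = j := by simpa using him
    exact this ▸ hm

theorem continuous_of_tendsto_zero [T1Space K] {g : K → ℝ} (hmid : ∀ i, g (d.mid i) = 0)
    (htop : ∀ p, g (d.top p) = 0) (h0 : Tendsto (fun n => g (d.isol n)) cofinite (𝓝 0)) :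
    Continuous g := by
  have hzero : ∀ z, g z = 0 → ContinuousAt g z := fun z hz => by
    rw [ContinuousAt, hz]
    intro s hs
    rw [Filter.mem_map]
    have hfin := (mem_cofinite.1 (h0 hs)).image d.isol
    have h0s : (0 : ℝ) ∈ s := mem_of_mem_nhds hs
    refine mem_of_superset (hfin.isClosed.isOpen_compl.mem_nhds ?_) fun w hw => ?_
    · rintro ⟨n, hn, rfl⟩
      exact hn (by simpa [hz] using h0s)
    · by_contra hws
      refine hw ?_
      induction w using d.cases_pt with
      | h₀ n => exact ⟨n, hws, rfl⟩
      | h₁ i => exact absurd (by simpa [hmid] using h0s) hws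
      | h₂ p => exact absurd (by simpa [htop] using h0s) hws
  refine continuous_iff_continuousAt.2 fun z => d.cases_pt (fun n => ?_)
    (fun i => hzero _ (hmid i)) (fun p => hzero _ (htop p)) z
  rw [ContinuousAt, isOpen_singleton_iff_nhds_eq_pure _ |>.1 (d.isOpen_isol n)]
  exact tendsto_pure_nhds _ _

/-- The set of isolated points in a basic neighbourhood, as a set of natural numbers. -/
def trace (i : ι) : Set ℕ := {n | d.isol n ∈ d.nbhd i}

theorem trace_infinite (i : ι) : (d.trace i).Infinite := fun hfin => by
  refine d.infinite_nbhd i (((hfin.image d.isol).union (finite_singleton (d.mid i))).subset ?_)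
  intro z hz
  induction z using d.cases_pt with
  | h₀ n => exact Or.inl ⟨n, hz, rfl⟩
  | h₁ j => exact Or.inr (congrArg d.mid ((d.mid_mem_nbhd i j).1 hz))
  | h₂ p => exact absurd hz (by simp)

theorem trace_inter_finite [CompactSpace K] : Pairwise fun i j => (d.trace i ∩ d.trace j).Finite :=
  fun i j hij => d.finite_of_isCompact_subset_range
    ((d.isClopen_nbhd i).inter (d.isClopen_nbhd j)).isClosed.isCompact fun z =>
      d.cases_pt (P := fun z => z ∈ d.nbhd i ∩ d.nbhd j → _) (fun n _ => ⟨n, rfl⟩)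
        (fun k hk => absurd (((d.mid_mem_nbhd i k).1 hk.1).symm.trans ((d.mid_mem_nbhd j k).1 hk.2))
          hij) (fun p hp => absurd hp.1 (by simp)) z

theorem tendsto_isol_mid [CompactSpace K] {i : ι} {a : ℕ → ℕ} (ha : Function.Injective a)
    (hai : ∀ j, a j ∈ d.trace i) : Tendsto (fun j => d.isol (a j)) cofinite (𝓝 (d.mid i)) := by
  refine tendsto_nhds.2 fun W hW hmem => mem_cofinite.2 ?_
  have hfin := d.finite_of_isCompact_subset_range (C := d.nbhd i \ W)
    ((d.isClopen_nbhd i).isClosed.sdiff hW).isCompact fun z =>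
      d.cases_pt (P := fun z => z ∈ d.nbhd i \ W → _) (fun n _ => ⟨n, rfl⟩)
        (fun k hk => absurd ((d.mid_mem_nbhd i k).1 hk.1 ▸ hmem) hk.2)
        (fun p hp => absurd hp.1 (by simp)) z
  exact (hfin.preimage ha.injOn).subset fun j hj => ⟨hai j, hj⟩

/-- Evaluation at the points of rank two. -/
noncomputable def topEval : C(K, ℝ) →L[ℝ] (Φ → ℝ) :=
  ContinuousLinearMap.pi fun p => ContinuousMap.evalCLM ℝ (d.top p)

@[simp]
theorem topEval_apply (f : C(K, ℝ)) (p : Φ) : d.topEval f p = f (d.top p) := rfl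

theorem mem_ker_topEval {f : C(K, ℝ)} : f ∈ d.topEval.ker ↔ ∀ p, f (d.top p) = 0 :=
  LinearMap.mem_ker.trans funext_iff

/-- Evaluation at the points of rank one, for functions vanishing at the points of rank two. -/
noncomputable def midEval : d.topEval.ker →L[ℝ] (ι → ℝ) :=
  ContinuousLinearMap.pi fun i => (ContinuousMap.evalCLM ℝ (d.mid i)).comp d.topEval.ker.subtypeL

@[simp]
theorem midEval_apply (f : d.topEval.ker) (i : ι) : d.midEval f i = (f : C(K, ℝ)) (d.mid i) := rfl

theorem top_eq_zero (f : d.topEval.ker) (p : Φ) : (f : C(K, ℝ)) (d.top p) = 0 :=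
  d.mem_ker_topEval.1 f.2 p

variable [CompactSpace K]

theorem norm_le_of_levels {f : C(K, ℝ)} {C : ℝ} (hC : 0 ≤ C) (h₀ : ∀ n, |f (d.isol n)| ≤ C)
    (h₁ : ∀ i, |f (d.mid i)| ≤ C) (h₂ : ∀ p, |f (d.top p)| ≤ C) : ‖f‖ ≤ C :=
  (ContinuousMap.norm_le f hC).2 fun z =>
    d.cases_pt (P := fun z => ‖f z‖ ≤ C) h₀ h₁ h₂ z

theorem isCompact_le_abs (f : C(K, ℝ)) (ε : ℝ) : IsCompact {z | ε ≤ |f z|} :=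
  (isClosed_le continuous_const f.continuous.abs).isCompact

theorem finite_le_abs_isol {f : C(K, ℝ)} {ε : ℝ} (hmid : ∀ i, |f (d.mid i)| < ε)
    (htop : ∀ p, |f (d.top p)| < ε) : {n | ε ≤ |f (d.isol n)|}.Finite :=
  d.finite_of_isCompact_subset_range (isCompact_le_abs f ε) fun z =>
    d.cases_pt (P := fun z => ε ≤ |f z| → _) (fun n _ => ⟨n, rfl⟩)
      (fun i hi => absurd (hmid i) (not_lt.2 hi)) (fun p hp => absurd (htop p) (not_lt.2 hp)) z

theorem finite_le_abs_mid {f : C(K, ℝ)} {ε : ℝ} (htop : ∀ p, |f (d.top p)| < ε) :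
    {i | ε ≤ |f (d.mid i)|}.Finite :=
  d.finite_mid_mem (isCompact_le_abs f ε) fun p hp => absurd (htop p) (not_lt.2 hp)

variable [T1Space K]

/-- A closed subspace that contains the indicators of the basic neighbourhoods and of the isolated
points contains every function vanishing at the points of rank two. -/
theorem ker_topEval_le {S : Submodule ℝ C(K, ℝ)} (hS : IsClosed (S : Set C(K, ℝ)))
    (hmid : ∀ i, clopenIndicator (d.isClopen_nbhd i) ∈ S)
    (hisol : ∀ n, clopenIndicator (d.isClopen_isol n) ∈ S) : d.topEval.ker ≤ S := by
  classical
  intro f hf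
  rw [mem_ker_topEval] at hf
  rw [← SetLike.mem_coe, ← hS.closure_eq]
  refine Metric.mem_closure_iff.2 fun ε hε => ?_
  have hI := d.finite_le_abs_mid (f := f) (ε := ε / 2) (fun p => by simpa [hf] using hε)
  -- `g` corrects the finitely many large values at rank-one points. Then `f - g` is large at only
  -- finitely many isolated points, and `h` removes those.
  set g : C(K, ℝ) :=
    ∑ i ∈ hI.toFinset, f (d.mid i) • clopenIndicator (d.isClopen_nbhd i) with hg
  have hgmid : ∀ j, g (d.mid j) = if ε / 2 ≤ |f (d.mid j)| then f (d.mid j) else 0 := fun j => by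
    simp [hg, ContinuousMap.sum_apply, Set.indicator_apply, eq_comm (a := j)]
  have hgtop : ∀ p, g (d.top p) = 0 := fun p => by
    simp [hg, ContinuousMap.sum_apply]
  have hfgmid : ∀ j, |(f - g) (d.mid j)| < ε / 2 := fun j => by
    rw [ContinuousMap.sub_apply, hgmid]
    split_ifs with h
    · simpa using hε
    · simpa using h
  have hfgtop : ∀ p, |(f - g) (d.top p)| < ε / 2 := fun p => by
    simpa [hf, hgtop] using hε
  have hJ := d.finite_le_abs_isol hfgmid hfgtop
  set h : C(K, ℝ) :=
    ∑ n ∈ hJ.toFinset, (f - g) (d.isol n) • clopenIndicator (d.isClopen_isol n) with hh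
  have hhisol : ∀ n, h (d.isol n) =
      if ε / 2 ≤ |(f - g) (d.isol n)| then (f - g) (d.isol n) else 0 := fun n => by
    simp [hh, ContinuousMap.sum_apply, Set.indicator_apply, d.isol_injective.eq_iff]
  have hhmid : ∀ i, h (d.mid i) = 0 := fun i => by
    simp [hh, ContinuousMap.sum_apply]
  have hhtop : ∀ p, h (d.top p) = 0 := fun p => by
    simp [hh, ContinuousMap.sum_apply]
  refine ⟨g + h, S.add_mem (S.sum_mem fun i _ => S.smul_mem _ (hmid i))
    (S.sum_mem fun n _ => S.smul_mem _ (hisol n)), ?_⟩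
  rw [dist_eq_norm, sub_add_eq_sub_sub]
  refine (d.norm_le_of_levels (half_pos hε).le (fun n => ?_) (fun i => ?_) fun p => ?_).trans_lt
    (half_lt_self hε)
  · rw [ContinuousMap.sub_apply, hhisol]
    split_ifs with hn
    · simpa using (half_pos hε).le
    · rw [_root_.sub_zero]
      exact (not_le.1 hn).le
  · rw [ContinuousMap.sub_apply, hhmid, _root_.sub_zero]
    exact (hfgmid i).le
  · rw [ContinuousMap.sub_apply, hhtop, _root_.sub_zero]
    exact (hfgtop p).le

/-- Extension by zero. With `a = id` it inverts restriction on the kernel of `midEval`; with `a`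
running through one trace it is the section that splits off c₀. -/
theorem exists_extendCZero {a : ℕ → ℕ} (ha : Function.Injective a) :
    ∃ R : C₀(ℕ, ℝ) →L[ℝ] d.topEval.ker, ∀ c,
      (∀ j, (R c : C(K, ℝ)) (d.isol (a j)) = c j) ∧
      (∀ n, n ∉ range a → (R c : C(K, ℝ)) (d.isol n) = 0) ∧
      ∀ i, (R c : C(K, ℝ)) (d.mid i) = 0 := by
  let g : C₀(ℕ, ℝ) → K → ℝ := fun c => d.ofLevels (Function.extend a c 0) 0 0
  have hg : ∀ c, Continuous (g c) := fun c => by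
    refine d.continuous_of_tendsto_zero (by simp [g]) (by simp [g]) fun s hs => ?_
    refine mem_cofinite.2 (((mem_cofinite.1 (c.tendsto_cofinite hs)).image a).subset fun n hn => ?_)
    have h0s : (0 : ℝ) ∈ s := mem_of_mem_nhds hs
    by_cases hna : n ∈ range a
    · obtain ⟨j, rfl⟩ := hna
      exact ⟨j, by simpa [g, ha.extend_apply] using hn, rfl⟩
    · refine absurd ?_ hn
      simpa [g, Function.extend_apply' _ _ _ hna] using h0s
  let R : C₀(ℕ, ℝ) →ₗ[ℝ] d.topEval.ker :=
    { toFun := fun c => ⟨⟨g c, hg c⟩, d.mem_ker_topEval.2 fun p => by simp [g]⟩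
      map_add' := fun c c' => by
        refine Subtype.ext (ContinuousMap.ext fun z => ?_)
        induction z using d.cases_pt with
        | h₀ n =>
          by_cases hna : n ∈ range a
          · obtain ⟨j, rfl⟩ := hna
            simp [g, ha.extend_apply]
          · simp [g, Function.extend_apply' _ _ _ hna]
        | h₁ i => simp [g]
        | h₂ p => simp [g]
      map_smul' := fun r c => by
        refine Subtype.ext (ContinuousMap.ext fun z => ?_)
        induction z using d.cases_pt with
        | h₀ n =>
          by_cases hna : n ∈ range a
          · obtain ⟨j, rfl⟩ := hna
            simp [g, ha.extend_apply]
          · simp [g, Function.extend_apply' _ _ _ hna]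
        | h₁ i => simp [g]
        | h₂ p => simp [g] }
  refine ⟨R.mkContinuous 1 fun c => ?_, fun c => ⟨fun j => ?_, fun n hn => ?_, fun i => ?_⟩⟩
  · rw [one_mul]
    refine d.norm_le_of_levels (f := (R c : C(K, ℝ))) (norm_nonneg c) (fun n => ?_) (fun i => ?_)
      fun p => ?_
    · by_cases hna : n ∈ range a
      · obtain ⟨j, rfl⟩ := hna
        simpa [R, g, ha.extend_apply] using c.norm_apply_le j
      · simp [R, g, Function.extend_apply' _ _ _ hna]
    · simp [R, g]
    · simp [R, g]
  · simp [R, g, ha.extend_apply]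
  · simp [R, g, Function.extend_apply' _ _ _ hn]
  · simp [R, g]

theorem nonempty_ker_midEval_equiv : Nonempty (d.midEval.ker ≃L[ℝ] C₀(ℕ, ℝ)) := by
  have hmid : ∀ (f : d.midEval.ker) (i : ι), (f : C(K, ℝ)) (d.mid i) = 0 := fun f i =>
    congrFun (LinearMap.mem_ker.1 f.2) i
  have htop : ∀ (f : d.midEval.ker) (p : Φ), (f : C(K, ℝ)) (d.top p) = 0 := fun f =>
    d.top_eq_zero f.1
  obtain ⟨Q, hQ⟩ := exists_clm_cZero (E := d.midEval.ker)
    (fun n => (ContinuousMap.evalCLM ℝ (d.isol n)).comp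
      (d.topEval.ker.subtypeL.comp d.midEval.ker.subtypeL)) 1
    (fun n f => by
      rw [one_mul]
      exact (f : C(K, ℝ)).norm_coe_le_norm (d.isol n))
    (fun f => by
      refine Metric.tendsto_nhds.2 fun ε hε => ?_
      have := d.finite_le_abs_isol (f := (f : C(K, ℝ))) (ε := ε)
        (by simpa [hmid] using fun _ => hε) (by simpa [htop] using fun _ => hε)
      refine mem_cofinite.2 (this.subset fun n hn => ?_)
      simpa using hn)
  obtain ⟨R, hR⟩ := d.exists_extendCZero Function.injective_id
  refine ⟨ContinuousLinearEquiv.equivOfInverse Q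
    (R.codRestrict d.midEval.ker fun c => LinearMap.mem_ker.2 (funext (hR c).2.2))
    (fun f => ?_) fun c => ?_⟩
  · refine Subtype.ext (Subtype.ext (ContinuousMap.ext fun z => ?_))
    induction z using d.cases_pt with
    | h₀ n => exact ((hR _).1 n).trans (hQ f n)
    | h₁ i => exact ((hR _).2.2 i).trans (hmid f i).symm
    | h₂ p => exact (d.top_eq_zero _ p).trans (htop f p).symm
  · ext n
    exact (hQ _ n).trans ((hR c).1 n)

/-- Along a sequence of isolated points converging to `d.mid i`, the differences from the value at
the limit form a null sequence. Extension by zero, which vanishes at `d.mid i`, is a right inverse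
of this map. -/
theorem exists_ker_topEval_equiv_prod (i : ι) :
    ∃ W : Submodule ℝ d.topEval.ker, Nonempty (d.topEval.ker ≃L[ℝ] (C₀(ℕ, ℝ) × W)) := by
  have := (d.trace_infinite i).to_subtype
  let a : ℕ → ℕ := fun j => Infinite.natEmbedding (d.trace i) j
  have ha : Function.Injective a :=
    Subtype.val_injective.comp (Infinite.natEmbedding (d.trace i)).injective
  have hai : ∀ j, a j ∈ d.trace i := fun j => (Infinite.natEmbedding (d.trace i) j).2
  obtain ⟨P, hP⟩ := exists_clm_cZero (E := d.topEval.ker)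
    (fun j => (ContinuousMap.evalCLM ℝ (d.isol (a j)) - ContinuousMap.evalCLM ℝ (d.mid i) :
      C(K, ℝ) →L[ℝ] ℝ).comp d.topEval.ker.subtypeL) 2
    (fun j f => by
      refine (norm_sub_le _ _).trans ?_
      rw [two_mul]
      exact add_le_add ((f : C(K, ℝ)).norm_coe_le_norm _) ((f : C(K, ℝ)).norm_coe_le_norm _))
    (fun f => by
      have := ((f : C(K, ℝ)).continuous.tendsto _).comp (d.tendsto_isol_mid ha hai)
      simpa using this.sub_const ((f : C(K, ℝ)) (d.mid i)))
  obtain ⟨R, hR⟩ := d.exists_extendCZero ha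
  refine ⟨P.ker, ⟨ContinuousLinearEquiv.equivOfRightInverse P R fun c => ?_⟩⟩
  ext j
  rw [hP]
  simp [(hR c).1, (hR c).2.2]

end ThreeLevels

/-! ### The operator induced by a transfer, and absorption of c₀ -/

namespace ThreeLevels

open Filter ZeroAtInfty

variable {K₀ K₁ ι Φ₀ Φ₁ : Type u} [TopologicalSpace K₀] [CompactSpace K₀] [T1Space K₀]
  [TopologicalSpace K₁] [CompactSpace K₁] [T1Space K₁]

open Classical in
theorem exists_clm_of_transfer (d₀ : ThreeLevels K₀ ι Φ₀) (d₁ : ThreeLevels K₁ ι Φ₁)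
    {s : ℕ → Finset ℕ} (hcard : ∀ n, (s n).card ≤ 2) (hle : ∀ n, ∀ k ∈ s n, n ≤ k)
    (hs : ∀ i, ∃ n₀, ∀ n, n₀ ≤ n →
      ((s n).filter (· ∈ d₀.trace i)).card = if n ∈ d₁.trace i then 1 else 0) :
    ∃ T : d₀.topEval.ker →L[ℝ] d₁.topEval.ker, ∀ f, d₁.midEval (T f) = d₀.midEval f := by
  let T₀ : C(K₀, ℝ) → K₁ → ℝ := fun f =>
    d₁.ofLevels (fun n => ∑ k ∈ s n, f (d₀.isol k)) (fun i => f (d₀.mid i)) 0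
  have hadd : ∀ f g, T₀ (f + g) = T₀ f + T₀ g := fun f g => funext fun z => by
    induction z using d₁.cases_pt <;> simp [T₀, Finset.sum_add_distrib]
  have hsmul : ∀ (c : ℝ) f, T₀ (c • f) = c • T₀ f := fun c f => funext fun z => by
    induction z using d₁.cases_pt <;> simp [T₀, Finset.mul_sum]
  have hsub : ∀ f g, T₀ (f - g) = T₀ f - T₀ g := fun f g => funext fun z => by
    induction z using d₁.cases_pt <;> simp [T₀]
  have hzero : T₀ 0 = 0 := funext fun z => by
    induction z using d₁.cases_pt <;> simp [T₀]
  have hnorm : ∀ f z, |T₀ f z| ≤ 2 * ‖f‖ := fun f z => by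
    induction z using d₁.cases_pt with
    | h₀ n =>
      simp only [T₀, ofLevels_isol]
      refine (Finset.abs_sum_le_sum_abs _ _).trans
        ((Finset.sum_le_card_nsmul _ _ ‖f‖ fun k _ => f.norm_coe_le_norm _).trans ?_)
      rw [_root_.nsmul_eq_mul]
      gcongr
      exact_mod_cast hcard n
    | h₁ i =>
      simp only [T₀, ofLevels_mid]
      exact (f.norm_coe_le_norm _).trans (by linarith [norm_nonneg f])
    | h₂ p => simp [T₀]
  -- Only continuity of `T₀ f` is in doubt. It passes to uniform limits, so by `ker_topEval_le` it
  -- suffices to check the indicators of basic neighbourhoods and of isolated points.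
  let S : Submodule ℝ C(K₀, ℝ) :=
    { carrier := {f | Continuous (T₀ f)}
      add_mem' := fun {f g} hf hg => by
        simp only [Set.mem_ofPred_eq, hadd] at *
        exact hf.add hg
      zero_mem' := by
        simp only [Set.mem_ofPred_eq, hzero]
        exact continuous_zero
      smul_mem' := fun c f hf => by
        simp only [Set.mem_ofPred_eq, hsmul] at *
        exact hf.const_smul c }
  have hSmem : ∀ f, f ∈ S ↔ Continuous (T₀ f) := fun f => Iff.rfl
  have hSclosed : IsClosed (S : Set C(K₀, ℝ)) := by
    refine isClosed_of_closure_subset fun f hf => ?_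
    refine continuous_of_uniform_approx_of_continuous fun v hv => ?_
    obtain ⟨ε, hε, hεv⟩ := Metric.mem_uniformity_dist.1 hv
    obtain ⟨g, hg, hfg⟩ := Metric.mem_closure_iff.1 hf (ε / 2) (half_pos hε)
    refine ⟨T₀ g, hg, fun z => hεv ?_⟩
    rw [Real.dist_eq, ← Pi.sub_apply, ← hsub]
    refine (hnorm _ z).trans_lt ?_
    rw [dist_eq_norm] at hfg
    linarith
  have hev : ∀ {a : ℕ → ℝ} (n₀ : ℕ), (∀ n, n₀ ≤ n → a n = 0) → Tendsto a cofinite (𝓝 0) :=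
    fun n₀ h => by
      rw [Nat.cofinite_eq_atTop]
      exact tendsto_const_nhds.congr' (eventually_atTop.2 ⟨n₀, fun n hn => (h n hn).symm⟩)
  have hS : d₀.topEval.ker ≤ S := by
    refine d₀.ker_topEval_le hSclosed (fun i => ?_) fun k => ?_
    · obtain ⟨n₀, hn₀⟩ := hs i
      -- By the transfer property, the image of the i-th indicator differs from the i-th indicator
      -- on `K₁` at only finitely many points, all of them isolated.
      have hc : Continuous (T₀ (clopenIndicator (d₀.isClopen_nbhd i)) -
          ⇑(clopenIndicator (d₁.isClopen_nbhd i))) := by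
        refine d₁.continuous_of_tendsto_zero (fun j => ?_) (fun p => by simp [T₀])
          (hev n₀ fun n hn => ?_)
        · simp [T₀, Set.indicator_apply]
        · have h1 : ∑ k ∈ s n, (d₀.nbhd i).indicator (1 : K₀ → ℝ) (d₀.isol k) =
              (((s n).filter (· ∈ d₀.trace i)).card : ℝ) := by
            rw [Finset.card_filter]
            push_cast
            exact Finset.sum_congr rfl fun k _ => rfl
          simp only [T₀, Pi.sub_apply, ofLevels_isol, clopenIndicator_apply]
          rw [h1, hn₀ n hn]
          by_cases h : d₁.isol n ∈ d₁.nbhd i <;> simp [trace, h]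
      rw [hSmem]
      simpa using hc.add (clopenIndicator (d₁.isClopen_nbhd i)).continuous
    -- Since s n contains only numbers at least `n`, the point `k` contributes only at positions n ≤
    -- k.
    · refine d₁.continuous_of_tendsto_zero (fun j => by simp [T₀]) (fun p => by simp [T₀])
        (hev (k + 1) fun n hn => ?_)
      simp only [T₀, ofLevels_isol, clopenIndicator_apply]
      refine Finset.sum_eq_zero fun m hm => Set.indicator_of_notMem (fun hmk => ?_) _
      have : m = k := d₀.isol_injective hmk
      have := hle n m hm
      omega
  let T : d₀.topEval.ker →ₗ[ℝ] d₁.topEval.ker :=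
    { toFun := fun f => ⟨⟨T₀ f, hS f.2⟩, d₁.mem_ker_topEval.2 fun p => by simp [T₀]⟩
      map_add' := fun f g => Subtype.ext (ContinuousMap.ext fun z => congrFun (hadd f g) z)
      map_smul' := fun c f => Subtype.ext (ContinuousMap.ext fun z => congrFun (hsmul c f) z) }
  refine ⟨T.mkContinuous 2 fun f => ?_, fun f => funext fun i => ?_⟩
  · exact (ContinuousMap.norm_le _ (by positivity)).2 fun z => hnorm f z
  · simp [T, T₀]

theorem nonempty_equiv_cZero_prod {K ι Φ : Type u} [TopologicalSpace K] [CompactSpace K]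
    [T2Space K] [Nonempty ι] [Finite Φ] (d : ThreeLevels K ι Φ) :
    Nonempty (C(K, ℝ) ≃L[ℝ] (d.topEval.ker × C₀(ℕ, ℝ))) := by
  have := Fintype.ofFinite Φ
  obtain ⟨W, ⟨e⟩⟩ := d.exists_ker_topEval_equiv_prod (Classical.arbitrary ι)
  obtain ⟨e₁⟩ := nonempty_pi_prod_cZero_equiv Φ
  obtain ⟨e₂⟩ := nonempty_cZero_prod_self_equiv
  -- The rank-two points form a finite closed set, so Tietze's theorem extends any values on it; a
  -- finite-dimensional quotient then splits.
  have hsurj : Function.Surjective d.topEval := fun c => by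
    have hfin : (range d.top).Finite := finite_range _
    have := hfin.to_subtype
    obtain ⟨g, hg⟩ := ContinuousMap.exists_restrict_eq (Y := ℝ) hfin.isClosed
      ⟨fun z => c ((Equiv.ofInjective _ d.top_injective).symm z), continuous_of_discreteTopology⟩
    refine ⟨g, funext fun p => ?_⟩
    have := DFunLike.congr_fun hg ⟨d.top p, p, rfl⟩
    simpa [Equiv.ofInjective_symm_apply] using this
  obtain ⟨r, hr⟩ := d.topEval.exists_rightInverse_of_surjective (LinearMap.range_eq_top.2 hsurj)
  let e₃ := ContinuousLinearEquiv.equivOfRightInverse d.topEval r (DFunLike.congr_fun hr)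
  -- With X = c₀ × W, the chain is C(K) ≃ ℝ^Φ × c₀ × W ≃ c₀ × W ≃ c₀ × c₀ × W ≃ c₀ × X.
  exact ⟨e₃.trans (((ContinuousLinearEquiv.refl ℝ (Φ → ℝ)).prodCongr e).trans
    ((ContinuousLinearEquiv.prodAssoc ℝ _ _ _).symm.trans
    ((e₁.prodCongr (ContinuousLinearEquiv.refl ℝ W)).trans
    ((e₂.symm.prodCongr (ContinuousLinearEquiv.refl ℝ W)).trans
    ((ContinuousLinearEquiv.prodAssoc ℝ _ _ _).trans
    (((ContinuousLinearEquiv.refl ℝ _).prodCongr e.symm).trans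
    (ContinuousLinearEquiv.prodComm ℝ _ _)))))))⟩

end ThreeLevels

theorem mainTheorem9 (κ : Cardinal.{u}) (hMA : MartinAxiom κ)
    (K₀ K₁ : Type u)
    [TopologicalSpace K₀] [CompactSpace K₀] [T2Space K₀] [TopologicalSpace.SeparableSpace K₀]
    [TopologicalSpace K₁] [CompactSpace K₁] [T2Space K₁] [TopologicalSpace.SeparableSpace K₁]
    (hs₀ : IsScatteredSpace K₀) (hs₁ : IsScatteredSpace K₁)
    (hh₀ : HasHeight K₀ 3) (hh₁ : HasHeight K₁ 3)
    (hw₀ : topWeight K₀ = κ) (hw₁ : topWeight K₁ = κ) :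
    Nonempty (C(K₀, ℝ) ≃L[ℝ] C(K₁, ℝ)) := by
  induction κ using Cardinal.inductionOn with | _ ι
  obtain ⟨hκ, h₀⟩ := hh₀.aleph0_le_topWeight_and_exists_threeLevels
  have : Infinite ι := Cardinal.infinite_iff.2 (hw₀ ▸ hκ)
  obtain ⟨Φ₀, _, ⟨d₀⟩⟩ := h₀ ι hw₀.symm
  obtain ⟨Φ₁, _, ⟨d₁⟩⟩ := hh₁.aleph0_le_topWeight_and_exists_threeLevels.2 ι hw₁.symm
  obtain ⟨s, hs, hs', hs''⟩ := hMA.exists_transfer d₀.trace_infinite d₀.trace_inter_finite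
    d₁.trace_inter_finite
  obtain ⟨t, ht, ht', ht''⟩ := hMA.exists_transfer d₁.trace_infinite d₁.trace_inter_finite
    d₀.trace_inter_finite
  obtain ⟨T, hT⟩ := d₀.exists_clm_of_transfer d₁ hs hs' hs''
  obtain ⟨R, hR⟩ := d₁.exists_clm_of_transfer d₀ ht ht' ht''
  obtain ⟨e⟩ := nonempty_prod_ker_equiv_of_comp_eq (X := d₀.topEval.ker)
    (Y := d₁.topEval.ker) (V := ι → ℝ) d₀.midEval d₁.midEval T R hT hR
  obtain ⟨k₀⟩ := d₀.nonempty_ker_midEval_equiv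
  obtain ⟨k₁⟩ := d₁.nonempty_ker_midEval_equiv
  obtain ⟨e₀⟩ := d₀.nonempty_equiv_cZero_prod
  obtain ⟨e₁⟩ := d₁.nonempty_equiv_cZero_prod
  -- C(K₀) ≃ X₀ × c₀ ≃ c₀ × X₁ ≃ C(K₁), where both kernels are identified with c₀.
  exact ⟨e₀.trans (((ContinuousLinearEquiv.refl ℝ _).prodCongr k₁.symm).trans
    (e.trans ((k₀.prodCongr (ContinuousLinearEquiv.refl ℝ _)).trans
    ((ContinuousLinearEquiv.prodComm ℝ _ _).trans e₁.symm))))⟩
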